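/- Let $\mathcal C$ be an exact Goursat category: a finitely complete regular category in which every (internal) equivalence relation is effective, i.e. is a kernel pair $R[f]$, and in which $R\circ S\circ R=S\circ R\circ S$ for all equivalence relations $R,S$ on the same object. Relations on $X$ are regarded as subobjects of $X\times X$; $\Delta_X$ is the discrete equivalence relation, $f^{-1}(S)$ the inverse image of a relation $S$ along $f$, and $f(S)$ its regular image along a regular epimorphism $f$ (in an exact Goursat category $f(S)$ is again an effective equivalence relation if $S$ is). An *epireflective subcategory* $\mathcal L$ of $\mathcal C$ is a full replete reflective subcategory all of whose unit components $\eta_A\colon A\to\lambda(A)$ are regular epimorphisms. It is a *Birkhoff subcategory* if moreover, for every regular epimorphism $f\colon X\to Y$ with $X\in\mathcal L$, one has $Y\in\mathcal L$. An *effective closure operator* assigns to every effective equivalence relation $S$ on an object $X$ of $\mathcal C$ an effective equivalence relation $\overline S$ on $X$ such that (1) $S\subseteq\overline S$; (2) $S\subseteq T$ implies $\overline S\subseteq\overline T$; (3) $\overline{f^{-1}(S)}\subseteq f^{-1}(\overline S)$ for every arrow $f\colon Y\to X$ of $\mathcal C$; (4) $\overline{\overline S}=\overline S$; (5) $\overline{f^{-1}(S)}=f^{-1}(\overline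 S)$ for every regular epimorphism $f\colon Y\to X$. It is a *Birkhoff closure operator* if moreover (6) $\overline{f(S)}=f(\overline S)$ for every regular epimorphism $f\colon X\to Y$ and every equivalence relation $S$ on $X$. **Proposition.** There is a bijection between the epireflective subcategories of $\mathcal C$ and the effective closure operators on $\mathcal C$ which sends $\mathcal L$ to the operator $\overline S=q^{-1}(R[\eta_{X/S}])$, where $q\colon X\to X/S$ is the quotient (coequaliser) of $X$ by $S$ and $\eta$ is the unit of the reflection, and whose inverse sends a closure operator to the full subcategory of those objects $X$ with $\overline{\Delta_X}=\Delta_X$. This bijection restricts to a bijection between the Birkhoff subcategories of $\mathcal C$ and the Birkhoff closure operators. -/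

import Mathlib

open CategoryTheory CategoryTheory.Limits

universe v u

namespace EffClosure

variable {C : Type u} [Category.{v} C] [Regular C]

/-- A relation on `X` is a subobject of `X ⨯ X`; this is its first projection. -/
noncomputable abbrev p₁ {X : C} (S : Subobject (X ⨯ X)) : (S : C) ⟶ X := S.arrow ≫ prod.fst

/-- The second projection of a relation on `X`. -/
noncomputable abbrev p₂ {X : C} (S : Subobject (X ⨯ X)) : (S : C) ⟶ X := S.arrow ≫ prod.snd

/-- The relation `S` on `X` is an (internal) equivalence relation. -/
def IsEquivRel {X : C} (S : Subobject (X ⨯ X)) : Prop := IsEquivalenceRelation (p₁ S) (p₂ S)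

/-- The relation `S` on `X` is an effective equivalence relation: the kernel pair of an arrow. -/
def IsEffective {X : C} (S : Subobject (X ⨯ X)) : Prop :=
  ∃ (Y : C) (f : X ⟶ Y), IsKernelPair f (p₁ S) (p₂ S)

/-- The inverse image `f⁻¹(S)` of a relation on `X` along `f : Y ⟶ X`. -/
noncomputable def inverseImage {Y X : C} (f : Y ⟶ X) (S : Subobject (X ⨯ X)) :
    Subobject (Y ⨯ Y) :=
  (Subobject.pullback (prod.map f f)).obj S

/-- The regular image `f(S)` of a relation on `X` along `f : X ⟶ Y`: the image of the arrow
`S ⟶ X ⨯ X ⟶ Y ⨯ Y`. -/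
noncomputable def directImage {X Y : C} (f : X ⟶ Y) (S : Subobject (X ⨯ X)) :
    Subobject (Y ⨯ Y) :=
  imageSubobject (S.arrow ≫ prod.map f f)

/-- The composite of two relations on `X`: the image of the span `X ⟵ R ×_X S ⟶ X` in `X ⨯ X`.
In set-theoretic terms, `(x, z)` belongs to it when `x R y` and `y S z` for some `y`. -/
noncomputable def relComp {X : C} (R S : Subobject (X ⨯ X)) : Subobject (X ⨯ X) :=
  imageSubobject (prod.lift (pullback.fst (p₂ R) (p₁ S) ≫ p₁ R) (pullback.snd (p₂ R) (p₁ S) ≫ p₂ S))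

instance {X Y : C} (f : X ⟶ Y) : Mono (prod.lift (pullback.fst f f) (pullback.snd f f)) where
  right_cancellation a b h := by
    apply pullback.hom_ext
    · simpa only [Category.assoc, prod.lift_fst] using congrArg (fun t => t ≫ prod.fst) h
    · simpa only [Category.assoc, prod.lift_snd] using congrArg (fun t => t ≫ prod.snd) h

/-- The kernel pair `R[f]` of `f : X ⟶ Y`, as a relation on `X`. -/
noncomputable def kernelRel {X Y : C} (f : X ⟶ Y) : Subobject (X ⨯ X) :=
  Subobject.mk (prod.lift (pullback.fst f f) (pullback.snd f f))

/-- The discrete equivalence relation `Δ_X` on `X`. -/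
noncomputable def diagRel (X : C) : Subobject (X ⨯ X) := Subobject.mk (diag X)

variable (C) in
/-- An exact category: a (finitely complete) regular category in which every equivalence relation
is effective. -/
class IsExactCategory : Prop where
  effective : ∀ {X : C} (S : Subobject (X ⨯ X)), IsEquivRel S → IsEffective S

variable (C) in
/-- The Goursat property: equivalence relations on the same object are `3`-permutable. -/
class IsGoursat : Prop where
  three_permutable : ∀ {X : C} (R S : Subobject (X ⨯ X)), IsEquivRel R → IsEquivRel S →
    relComp (relComp R S) R = relComp (relComp S R) S

section Generalized

/-- Membership of a generalized element `(a, b)` in a relation. -/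
def Rel {X T : C} (S : Subobject (X ⨯ X)) (a b : T ⟶ X) : Prop := S.Factors (prod.lift a b)

theorem rel_iff {X T : C} (S : Subobject (X ⨯ X)) (a b : T ⟶ X) :
    Rel S a b ↔ ∃ t : T ⟶ (S : C), t ≫ p₁ S = a ∧ t ≫ p₂ S = b := by
  constructor
  · intro h
    have h' : S.Factors (prod.lift a b) := h
    refine ⟨S.factorThru _ h', ?_, ?_⟩
    · rw [p₁, Subobject.factorThru_arrow_assoc, prod.lift_fst]
    · rw [p₂, Subobject.factorThru_arrow_assoc, prod.lift_snd]
  · rintro ⟨t, rfl, rfl⟩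
    have h : prod.lift (t ≫ p₁ S) (t ≫ p₂ S) = t ≫ S.arrow := by
      ext
      · rw [prod.lift_fst, Category.assoc]
      · rw [prod.lift_snd, Category.assoc]
    rw [Rel, h]
    exact Subobject.factors_comp_arrow t

theorem rel_mk {X Z T : C} (k : Z ⟶ X ⨯ X) [Mono k] (a b : T ⟶ X) :
    Rel (Subobject.mk k) a b ↔ ∃ t : T ⟶ Z, t ≫ k ≫ prod.fst = a ∧ t ≫ k ≫ prod.snd = b := by
  rw [rel_iff]
  constructor
  · rintro ⟨t, rfl, rfl⟩
    refine ⟨t ≫ (Subobject.underlyingIso k).hom, ?_, ?_⟩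
    · rw [p₁, Category.assoc, Subobject.underlyingIso_hom_comp_eq_mk_assoc]
    · rw [p₂, Category.assoc, Subobject.underlyingIso_hom_comp_eq_mk_assoc]
  · rintro ⟨t, rfl, rfl⟩
    refine ⟨t ≫ (Subobject.underlyingIso k).inv, ?_, ?_⟩
    · rw [p₁, Category.assoc, Subobject.underlyingIso_arrow_assoc]
    · rw [p₂, Category.assoc, Subobject.underlyingIso_arrow_assoc]

theorem Rel.comp {X T T' : C} {S : Subobject (X ⨯ X)} {a b : T ⟶ X} (h : Rel S a b)
    (e : T' ⟶ T) : Rel S (e ≫ a) (e ≫ b) := by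
  obtain ⟨t, rfl, rfl⟩ := (rel_iff _ _ _).1 h
  exact (rel_iff _ _ _).2 ⟨e ≫ t, by simp, by simp⟩

theorem Rel.descend {X T T' : C} {S : Subobject (X ⨯ X)} {a b : T ⟶ X} (e : T' ⟶ T)
    [IsRegularEpi e] (h : Rel S (e ≫ a) (e ≫ b)) : Rel S a b := by
  obtain ⟨t, h₁, h₂⟩ := (rel_iff _ _ _).1 h
  have sq : CommSq t e S.arrow (prod.lift a b) := ⟨by
    ext
    · rw [Category.assoc, Category.assoc, prod.lift_fst]; exact h₁
    · rw [Category.assoc, Category.assoc, prod.lift_snd]; exact h₂⟩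
  refine (rel_iff _ _ _).2 ⟨sq.lift, ?_, ?_⟩
  · rw [p₁, sq.fac_right_assoc, prod.lift_fst]
  · rw [p₂, sq.fac_right_assoc, prod.lift_snd]

theorem rel_image {X Z T : C} (k : Z ⟶ X ⨯ X) (a b : T ⟶ X) :
    Rel (imageSubobject k) a b ↔ ∃ (T' : C) (e : T' ⟶ T) (_ : IsRegularEpi e) (z : T' ⟶ Z),
      z ≫ k ≫ prod.fst = e ≫ a ∧ z ≫ k ≫ prod.snd = e ≫ b := by
  constructor
  · intro h
    obtain ⟨t, rfl, rfl⟩ := (rel_iff _ _ _).1 h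
    have hk : StrongEpi (factorThruImageSubobject k) := by
      have : StrongEpi (factorThruImage k) := inferInstance
      rw [factorThruImageSubobject]
      exact strongEpi_comp _ _
    have : IsRegularEpi (factorThruImageSubobject k) := inferInstance
    refine ⟨_, pullback.fst t (factorThruImageSubobject k), inferInstance, pullback.snd _ _, ?_, ?_⟩
    · rw [← Category.assoc, pullback.condition_assoc, p₁, imageSubobject_arrow_comp_assoc,
        Category.assoc]
    · rw [← Category.assoc, pullback.condition_assoc, p₂, imageSubobject_arrow_comp_assoc,
        Category.assoc]
  · rintro ⟨T', e, he, z, h₁, h₂⟩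
    refine Rel.descend e ((rel_iff _ _ _).2 ⟨z ≫ factorThruImageSubobject k, ?_, ?_⟩)
    · simpa [p₁] using h₁
    · simpa [p₂] using h₂

theorem rel_directImage {X Y T : C} (f : X ⟶ Y) (S : Subobject (X ⨯ X)) (a b : T ⟶ Y) :
    Rel (directImage f S) a b ↔ ∃ (T' : C) (e : T' ⟶ T) (_ : IsRegularEpi e) (x y : T' ⟶ X),
      Rel S x y ∧ x ≫ f = e ≫ a ∧ y ≫ f = e ≫ b := by
  rw [directImage, rel_image]
  constructor
  · rintro ⟨T', e, he, z, h₁, h₂⟩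
    exact ⟨T', e, he, z ≫ p₁ S, z ≫ p₂ S, (rel_iff _ _ _).2 ⟨z, rfl, rfl⟩,
      by simpa [p₁] using h₁, by simpa [p₂] using h₂⟩
  · rintro ⟨T', e, he, x, y, h, h₁, h₂⟩
    obtain ⟨z, rfl, rfl⟩ := (rel_iff _ _ _).1 h
    exact ⟨T', e, he, z, by simpa [p₁] using h₁, by simpa [p₂] using h₂⟩

theorem rel_relComp {X T : C} (R S : Subobject (X ⨯ X)) (a c : T ⟶ X) :
    Rel (relComp R S) a c ↔ ∃ (T' : C) (e : T' ⟶ T) (_ : IsRegularEpi e) (b : T' ⟶ X),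
      Rel R (e ≫ a) b ∧ Rel S b (e ≫ c) := by
  rw [relComp, rel_image]
  constructor
  · rintro ⟨T', e, he, z, h₁, h₂⟩
    refine ⟨T', e, he, z ≫ pullback.fst _ _ ≫ p₂ R, (rel_iff _ _ _).2 ⟨z ≫ pullback.fst _ _, ?_, ?_⟩,
      (rel_iff _ _ _).2 ⟨z ≫ pullback.snd _ _, ?_, ?_⟩⟩
    · rw [prod.lift_fst] at h₁; rw [Category.assoc, h₁]
    · rw [Category.assoc]
    · rw [Category.assoc, pullback.condition]
    · rw [prod.lift_snd] at h₂; rw [Category.assoc, h₂]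
  · rintro ⟨T', e, he, b, hR, hS⟩
    obtain ⟨r, h₁, h₂⟩ := (rel_iff _ _ _).1 hR
    obtain ⟨s, h₃, h₄⟩ := (rel_iff _ _ _).1 hS
    refine ⟨T', e, he, pullback.lift r s (h₂.trans h₃.symm), ?_, ?_⟩
    · rw [prod.lift_fst, pullback.lift_fst_assoc, h₁]
    · rw [prod.lift_snd, pullback.lift_snd_assoc, h₄]

theorem rel_kernelRel {X Y T : C} (f : X ⟶ Y) (a b : T ⟶ X) :
    Rel (kernelRel f) a b ↔ a ≫ f = b ≫ f := by
  constructor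
  · intro h
    obtain ⟨t, h₁, h₂⟩ := (rel_mk _ _ _).1 h
    rw [prod.lift_fst] at h₁
    rw [prod.lift_snd] at h₂
    rw [← h₁, ← h₂, Category.assoc, Category.assoc, pullback.condition]
  · intro h
    refine (rel_mk _ _ _).2 ⟨pullback.lift a b h, ?_, ?_⟩
    · rw [prod.lift_fst, pullback.lift_fst]
    · rw [prod.lift_snd, pullback.lift_snd]

theorem jointlyMono {X : C} (S : Subobject (X ⨯ X)) : JointlyMono₂ (p₁ S) (p₂ S) where
  right_cancellation Y f g h₁ h₂ := by
    rw [← cancel_mono S.arrow]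
    ext
    · simpa [p₁] using h₁
    · simpa [p₂] using h₂

theorem isEquivRel_iff {X : C} (S : Subobject (X ⨯ X)) :
    IsEquivRel S ↔ (∀ {T : C} (a : T ⟶ X), Rel S a a) ∧
      (∀ {T : C} (a b : T ⟶ X), Rel S a b → Rel S b a) ∧
      (∀ {T : C} (a b c : T ⟶ X), Rel S a b → Rel S b c → Rel S a c) := by
  constructor
  · rintro ⟨⟨h⟩⟩
    refine ⟨fun a => (rel_iff _ _ _).2 ⟨a ≫ h.r, ?_, ?_⟩, fun a b hab => ?_, fun a b c hab hbc => ?_⟩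
    · rw [Category.assoc, h.reflexivity₁, Category.comp_id]
    · rw [Category.assoc, h.reflexivity₂, Category.comp_id]
    · obtain ⟨t, rfl, rfl⟩ := (rel_iff _ _ _).1 hab
      refine (rel_iff _ _ _).2 ⟨t ≫ h.s, ?_, ?_⟩
      · rw [Category.assoc, h.symmetry₁]
      · rw [Category.assoc, h.symmetry₂]
    · obtain ⟨t, rfl, h₁⟩ := (rel_iff _ _ _).1 hab
      obtain ⟨s, h₂, rfl⟩ := (rel_iff _ _ _).1 hbc
      refine (rel_iff _ _ _).2
        ⟨PullbackCone.IsLimit.lift h.isLimit t s (h₁.trans h₂.symm) ≫ h.t, ?_, ?_⟩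
      · rw [Category.assoc, h.transitivity₁, PullbackCone.IsLimit.lift_fst_assoc]
      · rw [Category.assoc, h.transitivity₂, PullbackCone.IsLimit.lift_snd_assoc]
  · rintro ⟨hr, hs, ht⟩
    obtain ⟨r, hr₁, hr₂⟩ := (rel_iff _ _ _).1 (hr (𝟙 X))
    obtain ⟨s, hs₁, hs₂⟩ := (rel_iff _ _ _).1
      (hs _ _ ((rel_iff S _ _).2 ⟨𝟙 _, Category.id_comp _, Category.id_comp _⟩))
    obtain ⟨t, ht₁, ht₂⟩ := (rel_iff _ _ _).1
      (ht (pullback.fst (p₂ S) (p₁ S) ≫ p₁ S) _ (pullback.snd (p₂ S) (p₁ S) ≫ p₂ S)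
        ((rel_iff S _ _).2 ⟨pullback.fst _ _, rfl, rfl⟩)
        ((rel_iff S _ _).2 ⟨pullback.snd _ _, pullback.condition.symm, rfl⟩))
    exact ⟨⟨{ toJointlyMono₂ := jointlyMono S, r := r, reflexivity₁ := hr₁, reflexivity₂ := hr₂,
              s := s, symmetry₁ := hs₁, symmetry₂ := hs₂,
              c := PullbackCone.mk _ _ pullback.condition,
              isLimit := pullbackIsPullback _ _,
              t := t, transitivity₁ := ht₁, transitivity₂ := ht₂ }⟩⟩

theorem isEffective_of_rel {X Y : C} (S : Subobject (X ⨯ X)) (f : X ⟶ Y)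
    (h : ∀ {T : C} (a b : T ⟶ X), Rel S a b ↔ a ≫ f = b ≫ f) : IsEffective S := by
  refine ⟨Y, f, ⟨(h _ _).1 ((rel_iff _ _ _).2 ⟨𝟙 _, Category.id_comp _, Category.id_comp _⟩)⟩,
    ⟨PullbackCone.IsLimit.mk _
      (fun s => ((rel_iff S _ _).1 ((h s.fst s.snd).2 s.condition)).choose)
      (fun s => ((rel_iff S _ _).1 ((h s.fst s.snd).2 s.condition)).choose_spec.1)
      (fun s => ((rel_iff S _ _).1 ((h s.fst s.snd).2 s.condition)).choose_spec.2)
      (fun s m h₁ h₂ => (jointlyMono S).right_cancellation _ _ ?_ ?_)⟩⟩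
  · exact h₁.trans ((rel_iff S _ _).1 ((h s.fst s.snd).2 s.condition)).choose_spec.1.symm
  · exact h₂.trans ((rel_iff S _ _).1 ((h s.fst s.snd).2 s.condition)).choose_spec.2.symm

theorem rel_of_isKernelPair {X Y T : C} {S : Subobject (X ⨯ X)} {f : X ⟶ Y}
    (h : IsKernelPair f (p₁ S) (p₂ S)) (a b : T ⟶ X) : Rel S a b ↔ a ≫ f = b ≫ f := by
  rw [rel_iff]
  constructor
  · rintro ⟨t, rfl, rfl⟩
    exact (Category.assoc _ _ _).trans ((congrArg (t ≫ ·) h.w).trans (Category.assoc _ _ _).symm)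
  · exact fun w => ⟨h.lift a b w, h.lift_fst _ _ _, h.lift_snd _ _ _⟩

theorem rel_inverseImage {X Y T : C} (f : Y ⟶ X) (S : Subobject (X ⨯ X)) (a b : T ⟶ Y) :
    Rel (inverseImage f S) a b ↔ Rel S (a ≫ f) (b ≫ f) := by
  rw [rel_iff, rel_iff]
  obtain ⟨π, hp⟩ : ∃ π : (inverseImage f S : C) ⟶ (S : C),
      IsPullback π (inverseImage f S).arrow S.arrow (prod.map f f) :=
    ⟨_, Subobject.isPullback (prod.map f f) S⟩
  constructor
  · rintro ⟨t, rfl, rfl⟩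
    refine ⟨t ≫ π, ?_, ?_⟩
    · rw [p₁, p₁, Category.assoc, hp.w_assoc, prod.map_fst]
      simp only [Category.assoc]
    · rw [p₂, p₂, Category.assoc, hp.w_assoc, prod.map_snd]
      simp only [Category.assoc]
  · rintro ⟨t, h₁, h₂⟩
    have w : t ≫ S.arrow = prod.lift a b ≫ prod.map f f := by
      rw [prod.lift_map]
      ext
      · rw [prod.lift_fst, Category.assoc, h₁]
      · rw [prod.lift_snd, Category.assoc, h₂]
    refine ⟨hp.lift _ _ w, ?_, ?_⟩
    · rw [p₁, hp.lift_snd_assoc, prod.lift_fst]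
    · rw [p₂, hp.lift_snd_assoc, prod.lift_snd]

theorem rel_diagRel {X T : C} (a b : T ⟶ X) : Rel (diagRel X) a b ↔ a = b := by
  constructor
  · intro h
    obtain ⟨t, h₁, h₂⟩ := (rel_mk _ _ _).1 h
    rw [diag, prod.lift_fst] at h₁
    rw [diag, prod.lift_snd] at h₂
    rw [← h₁, ← h₂]
  · rintro rfl
    refine (rel_mk _ _ _).2 ⟨a, ?_, ?_⟩
    · rw [diag, prod.lift_fst, Category.comp_id]
    · rw [diag, prod.lift_snd, Category.comp_id]

theorem IsEffective.isEquivRel {X : C} {S : Subobject (X ⨯ X)} (h : IsEffective S) :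
    IsEquivRel S := by
  obtain ⟨Y, f, hf⟩ := h
  rw [isEquivRel_iff]
  simp only [rel_of_isKernelPair hf]
  exact ⟨fun _ => trivial, fun _ _ h => h.symm, fun _ _ _ h h' => h.trans h'⟩

theorem isEffective_kernelRel {X Y : C} (f : X ⟶ Y) : IsEffective (kernelRel f) :=
  isEffective_of_rel _ f (rel_kernelRel f)

theorem isEffective_diagRel (X : C) : IsEffective (diagRel X) :=
  isEffective_of_rel _ (𝟙 X) fun a b => by simp [rel_diagRel]

theorem IsEffective.inverseImage {X Y : C} (f : Y ⟶ X) {S : Subobject (X ⨯ X)}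
    (h : IsEffective S) : IsEffective (inverseImage f S) := by
  obtain ⟨Z, g, hg⟩ := h
  exact isEffective_of_rel _ (f ≫ g) fun a b => by
    simp [rel_inverseImage, rel_of_isKernelPair hg]

/-- In a Goursat category the regular image of an equivalence relation along a regular epimorphism
is an equivalence relation. -/
theorem IsEquivRel.directImage [IsGoursat C] {X Y : C} (f : X ⟶ Y) [IsRegularEpi f]
    {S : Subobject (X ⨯ X)} (hS : IsEquivRel S) : IsEquivRel (directImage f S) := by
  have hR : IsEquivRel (kernelRel f) := (isEffective_kernelRel f).isEquivRel
  have key := IsGoursat.three_permutable S (kernelRel f) hS hR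
  obtain ⟨hr, hs, ht⟩ := (isEquivRel_iff S).1 hS
  refine (isEquivRel_iff _).2 ⟨fun {T} a => ?_, fun {T} a b hab => ?_, fun {T} a b c hab hbc => ?_⟩
  · exact (rel_directImage _ _ _ _).2 ⟨pullback a f, pullback.fst a f, inferInstance,
      pullback.snd a f, pullback.snd a f, hr _, pullback.condition.symm, pullback.condition.symm⟩
  · obtain ⟨T', e, he, x, y, h, h₁, h₂⟩ := (rel_directImage _ _ _ _).1 hab
    exact (rel_directImage _ _ _ _).2 ⟨T', e, he, y, x, hs _ _ h, h₂, h₁⟩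
  · obtain ⟨T₁, e₁, he₁, x, y, hxy, hx, hy⟩ := (rel_directImage _ _ _ _).1 hab
    obtain ⟨T₂, e₂, he₂, y', z, hyz, hy', hz⟩ :=
      (rel_directImage _ _ _ _).1 (hbc.comp e₁)
    have h3 : Rel (relComp (relComp S (kernelRel f)) S) (e₂ ≫ x) z := by
      refine (rel_relComp _ _ _ _).2 ⟨T₂, 𝟙 _, inferInstance, y', ?_, by simpa using hyz⟩
      refine (rel_relComp _ _ _ _).2 ⟨T₂, 𝟙 _, inferInstance, e₂ ≫ y, ?_, ?_⟩
      · simpa using hxy.comp e₂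
      · rw [rel_kernelRel]; simp [hy, hy']
    rw [key] at h3
    obtain ⟨T₃, e₃, he₃, w, hw, hwz⟩ := (rel_relComp _ _ _ _).1 h3
    obtain ⟨T₄, e₄, he₄, p, hp, hpw⟩ := (rel_relComp _ _ _ _).1 hw
    rw [rel_kernelRel] at hp hwz
    have h4 : Rel (EffClosure.directImage f S) (e₄ ≫ e₃ ≫ e₂ ≫ e₁ ≫ a)
        (e₄ ≫ e₃ ≫ e₂ ≫ e₁ ≫ c) := by
      refine (rel_directImage _ _ _ _).2
        ⟨T₄, 𝟙 _, inferInstance, p, e₄ ≫ w, hpw, ?_, ?_⟩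
      · rw [← hp]; simp [hx]
      · simp [hwz, hz]
    exact (((h4.descend e₄).descend e₃).descend e₂).descend e₁

end Generalized

/-- An effective equivalence relation on `X`, as a subobject of `X ⨯ X`. -/
@[ext]
structure EffRel (X : C) where
  rel : Subobject (X ⨯ X)
  isEffective : IsEffective rel

noncomputable instance (X : C) : PartialOrder (EffRel X) := PartialOrder.lift EffRel.rel fun _ _ => EffRel.ext

/-- The discrete equivalence relation `Δ_X`. -/
noncomputable def EffRel.diag (X : C) : EffRel X := ⟨diagRel X, isEffective_diagRel X⟩

/-- The kernel pair `R[f]`. -/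
noncomputable def EffRel.ker {X Y : C} (f : X ⟶ Y) : EffRel X :=
  ⟨kernelRel f, isEffective_kernelRel f⟩

/-- The inverse image `f⁻¹(S)`. -/
noncomputable def EffRel.inv {Y X : C} (f : Y ⟶ X) (S : EffRel X) : EffRel Y :=
  ⟨inverseImage f S.rel, S.isEffective.inverseImage f⟩

/-- The regular image `f(S)` along a regular epimorphism in an exact Goursat category. -/
noncomputable def EffRel.image [IsExactCategory C] [IsGoursat C] {X Y : C} (f : X ⟶ Y)
    [IsRegularEpi f] (S : EffRel X) : EffRel Y :=
  ⟨directImage f S.rel, IsExactCategory.effective _ (S.isEffective.isEquivRel.directImage f)⟩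

variable (C)

/-- Effective closure operators on effective equivalence relations: idempotent closure operators
(the first four axioms) that commute with inverse images along regular epimorphisms. -/
@[ext]
structure EffectiveClosureOperator where
  /-- the closure of an effective equivalence relation -/
  cl : ∀ {X : C}, EffRel X → EffRel X
  le_cl : ∀ {X : C} (S : EffRel X), S ≤ cl S
  mono : ∀ {X : C} (S T : EffRel X), S ≤ T → cl S ≤ cl T
  cl_inv_le : ∀ {Y X : C} (f : Y ⟶ X) (S : EffRel X), cl (S.inv f) ≤ (cl S).inv f
  idem : ∀ {X : C} (S : EffRel X), cl (cl S) = cl S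
  cl_inv : ∀ {Y X : C} (f : Y ⟶ X) [IsRegularEpi f] (S : EffRel X),
    cl (S.inv f) = (cl S).inv f

/-- Epireflective subcategories: full replete reflective subcategories such that all components
of the unit are regular epimorphisms. A full subcategory is given by its class of objects. -/
@[ext]
structure EpireflectiveSubcategory where
  /-- the objects of the subcategory -/
  obj : ObjectProperty C
  replete : obj.IsClosedUnderIsomorphisms
  reflective : ∃ r : Reflective obj.ι, ∀ A : C, IsRegularEpi (r.adj.unit.app A)

variable {C}

/-- A Birkhoff subcategory is an epireflective subcategory closed under regular quotients. -/
def EpireflectiveSubcategory.IsBirkhoff (L : EpireflectiveSubcategory C) : Prop :=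
  ∀ {X Y : C} (f : X ⟶ Y), IsRegularEpi f → L.obj X → L.obj Y

/-- A Birkhoff closure operator is an effective closure operator that commutes with regular
images along regular epimorphisms. -/
def EffectiveClosureOperator.IsBirkhoff [IsExactCategory C] [IsGoursat C]
    (c : EffectiveClosureOperator C) : Prop :=
  ∀ {X Y : C} (f : X ⟶ Y) [IsRegularEpi f] (S : EffRel X),
    c.cl (S.image f) = (c.cl S).image f

end EffClosure

open EffClosure

namespace EffClosure

/-! Every effective equivalence relation is the kernel pair of a regular epimorphism `q`, so both
sides of the correspondence can be read off kernel pairs. For an epireflective `L`, the relation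
`q⁻¹(R[η])` is `R[q ≫ η]`, and the universal properties of `q` and `η` make it the least kernel pair
of an arrow into `L` that contains `R[q]` (`closure_ker`, `closure_le_ker`). This minimality settles
independence of choices, monotonicity, idempotence and axiom (3); axiom (5) holds because `f ≫ q` is
a quotient by `f⁻¹(R[q])`.

Conversely, axiom (5) gives `cl R[q] = q⁻¹(cl Δ)`, so an operator is determined by the closures of
diagonals. Dividing `A` by `cl Δ_A` gives the reflection into the objects with closed diagonal:
idempotence puts the quotient there, and axiom (3) gives its universal property.

For the Birkhoff part, images are handled through the adjunction `image_le_iff` between image and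
inverse image. -/

theorem exists_unit_desc {C : Type u} [Category.{v} C] {P : ObjectProperty C} (r : Reflective P.ι)
    {A Y : C} (hY : P Y) (f : A ⟶ Y) :
    ∃ g : (r.L.obj A).obj ⟶ Y, r.adj.unit.app A ≫ g = f :=
  ⟨((r.adj.homEquiv A ⟨Y, hY⟩).symm f).hom,
    (r.adj.homEquiv_unit _ _ _).symm.trans ((r.adj.homEquiv A ⟨Y, hY⟩).apply_symm_apply f)⟩

variable {C : Type u} [Category.{v} C] [Regular C]

/-! ### Calculus of effective relations by generalized elements -/

section Relations

theorem le_of_forall_rel {X : C} {S T : Subobject (X ⨯ X)}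
    (h : ∀ {W : C} (a b : W ⟶ X), Rel S a b → Rel T a b) : S ≤ T := by
  obtain ⟨t, h₁, h₂⟩ := (rel_iff _ _ _).1 (h (p₁ S) (p₂ S)
    ((rel_iff _ _ _).2 ⟨𝟙 _, Category.id_comp _, Category.id_comp _⟩))
  refine Subobject.le_of_comm t ?_
  ext
  · simpa [p₁] using h₁
  · simpa [p₂] using h₂

theorem Rel.mono {X W : C} {S T : Subobject (X ⨯ X)} (h : S ≤ T) {a b : W ⟶ X}
    (hab : Rel S a b) : Rel T a b :=
  Subobject.factors_of_le _ h hab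

namespace EffRel

theorem le_iff {X : C} {S T : EffRel X} :
    S ≤ T ↔ ∀ (W : C) (a b : W ⟶ X), Rel S.rel a b → Rel T.rel a b :=
  ⟨fun h _ _ _ hab => hab.mono h, fun h => le_of_forall_rel fun a b hab => h _ a b hab⟩

theorem ker_le_iff {X Y : C} {f : X ⟶ Y} {T : EffRel X} :
    ker f ≤ T ↔ ∀ (W : C) (a b : W ⟶ X), a ≫ f = b ≫ f → Rel T.rel a b := by
  simp only [le_iff, ker, rel_kernelRel]

theorem le_ker_iff {X Y : C} {f : X ⟶ Y} {S : EffRel X} :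
    S ≤ ker f ↔ ∀ (W : C) (a b : W ⟶ X), Rel S.rel a b → a ≫ f = b ≫ f := by
  simp only [le_iff, ker, rel_kernelRel]

theorem le_ker_iff_comp_eq {X Y : C} {f : X ⟶ Y} {S : EffRel X} :
    S ≤ ker f ↔ p₁ S.rel ≫ f = p₂ S.rel ≫ f := by
  rw [le_ker_iff]
  refine ⟨fun h => h _ _ _ ((rel_iff _ _ _).2 ⟨𝟙 _, Category.id_comp _, Category.id_comp _⟩),
    fun h W a b hab => ?_⟩
  obtain ⟨t, rfl, rfl⟩ := (rel_iff _ _ _).1 hab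
  simpa only [Category.assoc] using congrArg (t ≫ ·) h

theorem inv_le_inv {X Y : C} (f : Y ⟶ X) {S T : EffRel X} (h : S ≤ T) : S.inv f ≤ T.inv f := by
  simp only [le_iff, inv, rel_inverseImage] at h ⊢
  exact fun W a b hab => h _ _ _ hab

/-- A generalized element of `X` lifts along `f` after passing to a regular epimorphic cover. Two
successive covers lift both members of a pair, and membership in `T` descends along them. -/
theorem inv_le_inv_iff {X Y : C} (f : Y ⟶ X) [IsRegularEpi f] {S T : EffRel X} :
    S.inv f ≤ T.inv f ↔ S ≤ T := by
  refine ⟨fun h => le_iff.2 fun W a b hab => ?_, inv_le_inv f⟩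
  simp only [le_iff, inv, rel_inverseImage] at h
  let e₁ := pullback.fst a f
  let e₂ := pullback.fst (e₁ ≫ b) f
  have key : Rel T.rel (e₂ ≫ e₁ ≫ a) (e₂ ≫ e₁ ≫ b) := by
    have ha : e₂ ≫ e₁ ≫ a = (e₂ ≫ pullback.snd a f) ≫ f := by
      rw [Category.assoc, ← pullback.condition]
    have hb : e₂ ≫ e₁ ≫ b = pullback.snd (e₁ ≫ b) f ≫ f := pullback.condition
    rw [ha, hb]
    refine h _ _ _ ?_
    rw [← ha, ← hb]
    exact (hab.comp e₁).comp e₂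
  exact (key.descend e₂).descend e₁

theorem inv_injective {X Y : C} (f : Y ⟶ X) [IsRegularEpi f] :
    Function.Injective (inv f : EffRel X → EffRel Y) := fun _ _ h =>
  le_antisymm ((inv_le_inv_iff f).1 h.le) ((inv_le_inv_iff f).1 h.ge)

theorem ker_inv {X Y Z : C} (f : X ⟶ Y) (g : Y ⟶ Z) : (ker g).inv f = ker (f ≫ g) := by
  apply le_antisymm <;> simp [le_iff, inv, ker, rel_inverseImage, rel_kernelRel]

theorem diag_inv {X Y : C} (f : X ⟶ Y) : (diag Y).inv f = ker f := by
  apply le_antisymm <;> simp [le_iff, inv, ker, diag, rel_inverseImage, rel_kernelRel, rel_diagRel]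

theorem ker_comp_mono {X Y Z : C} (f : X ⟶ Y) (g : Y ⟶ Z) [Mono g] : ker (f ≫ g) = ker f := by
  apply le_antisymm <;> rw [ker_le_iff] <;> intro W a b h <;> simp only [ker, rel_kernelRel]
  · rwa [← cancel_mono g, Category.assoc, Category.assoc]
  · rw [reassoc_of% h]

theorem ker_le_ker_comp {X Y Z : C} (f : X ⟶ Y) (g : Y ⟶ Z) : ker f ≤ ker (f ≫ g) := by
  rw [ker_le_iff]
  intro W a b h
  simp only [ker, rel_kernelRel]
  rw [reassoc_of% h]

theorem mono_of_ker_le_diag {X Y : C} {f : X ⟶ Y} (h : ker f ≤ diag X) : Mono f where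
  right_cancellation a b hab := (rel_diagRel _ _).1 (ker_le_iff.1 h _ a b hab)

theorem diag_le {X : C} (S : EffRel X) : diag X ≤ S := by
  refine le_iff.2 fun W a b h => ?_
  rw [diag, rel_diagRel] at h
  subst h
  exact ((isEquivRel_iff S.rel).1 S.isEffective.isEquivRel).1 a

theorem ker_id (X : C) : ker (𝟙 X) = diag X := by
  rw [← diag_inv]
  apply le_antisymm <;> simp [le_iff, inv, rel_inverseImage]

/-- The mono part of the image factorisation of `f` does not change its kernel pair. -/
theorem exists_quotient {X : C} (S : EffRel X) :
    ∃ (Q : C) (q : X ⟶ Q), IsRegularEpi q ∧ ker q = S := by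
  obtain ⟨Y, f, hf⟩ := S.isEffective
  refine ⟨_, (Regular.strongEpiMonoFactorisation f).e, inferInstance, ?_⟩
  rw [← ker_comp_mono _ (Regular.strongEpiMonoFactorisation f).m, MonoFactorisation.fac]
  apply le_antisymm <;> simp [le_iff, ker, rel_kernelRel, rel_of_isKernelPair hf]

theorem exists_desc {X Q Y : C} (q : X ⟶ Q) [IsRegularEpi q] {f : X ⟶ Y} (h : ker q ≤ ker f) :
    ∃ g : Q ⟶ Y, q ≫ g = f :=
  ⟨IsRegularEpi.desc q f (le_ker_iff.1 h _ _ _ ((rel_kernelRel _ _ _).2 (IsRegularEpi.w q))),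
    IsRegularEpi.fac _ _ _⟩

/-- As `S` is already some `R[f]`, the arrow `f` coequalises it and factors through `q`, whence
`R[q] ≤ R[f]`. -/
theorem ker_eq_of_isColimit {X Q : C} {S : EffRel X} {q : X ⟶ Q}
    (w : p₁ S.rel ≫ q = p₂ S.rel ≫ q) (hq : IsColimit (Cofork.ofπ q w)) : ker q = S := by
  refine le_antisymm ?_ (le_ker_iff_comp_eq.2 w)
  obtain ⟨Y, f, -, rfl⟩ := S.exists_quotient
  obtain ⟨g, hg⟩ : ∃ g : Q ⟶ Y, q ≫ g = f :=
    ⟨_, Cofork.IsColimit.π_desc' hq f (le_ker_iff_comp_eq.1 le_rfl)⟩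
  rw [← hg]
  exact ker_le_ker_comp _ _

theorem image_le_iff [IsExactCategory C] [IsGoursat C] {X Y : C} (f : X ⟶ Y) [IsRegularEpi f]
    {S : EffRel X} {T : EffRel Y} : S.image f ≤ T ↔ S ≤ T.inv f := by
  simp only [le_iff, image, inv, rel_inverseImage, rel_directImage]
  constructor
  · exact fun h W a b hab => h _ _ _ ⟨W, 𝟙 _, inferInstance, a, b, hab, by simp, by simp⟩
  · rintro h W a b ⟨T', e, he, x, y, hxy, hx, hy⟩
    have := h _ _ _ hxy
    rw [hx, hy] at this
    exact this.descend e

theorem image_diag [IsExactCategory C] [IsGoursat C] {X Y : C} (f : X ⟶ Y) [IsRegularEpi f] :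
    (diag X).image f = diag Y :=
  le_antisymm ((image_le_iff f).2 (diag_le _)) (diag_le _)

end EffRel

theorem isRegularEpi_comp {X Y Z : C} (f : X ⟶ Y) (g : Y ⟶ Z) [IsRegularEpi f] [IsRegularEpi g] :
    IsRegularEpi (f ≫ g) := by
  have : StrongEpi (f ≫ g) := strongEpi_comp _ _
  infer_instance

theorem isRegularEpi_of_comp {X Y Z : C} (f : X ⟶ Y) (g : Y ⟶ Z) [IsRegularEpi (f ≫ g)] :
    IsRegularEpi g := by
  have : StrongEpi g := strongEpi_of_strongEpi f g
  infer_instance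

end Relations

/-! ### From epireflective subcategories to closure operators -/

namespace EpireflectiveSubcategory

variable (L : EpireflectiveSubcategory C)

/-- The arrow `f` factors through `q`, and then through the unit because `Y` lies in `L`. This is
the minimality from which the rest of the section follows. -/
theorem ker_comp_unit_le (r : Reflective L.obj.ι) {X Q Y : C} (q : X ⟶ Q) [IsRegularEpi q]
    (hY : L.obj Y) {f : X ⟶ Y} (h : EffRel.ker q ≤ EffRel.ker f) :
    EffRel.ker (q ≫ r.adj.unit.app Q) ≤ EffRel.ker f := by
  obtain ⟨g, rfl⟩ := EffRel.exists_desc q h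
  obtain ⟨k, rfl⟩ := exists_unit_desc r hY g
  rw [← Category.assoc]
  exact EffRel.ker_le_ker_comp _ _

theorem ker_comp_unit_eq (r r' : Reflective L.obj.ι) {X Q Q' : C} (q : X ⟶ Q) [IsRegularEpi q]
    (q' : X ⟶ Q') [IsRegularEpi q'] (h : EffRel.ker q = EffRel.ker q') :
    EffRel.ker (q ≫ r.adj.unit.app Q) = EffRel.ker (q' ≫ r'.adj.unit.app Q') :=
  le_antisymm
    (L.ker_comp_unit_le r q (r'.L.obj Q').property (h.le.trans (EffRel.ker_le_ker_comp _ _)))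
    (L.ker_comp_unit_le r' q' (r.L.obj Q).property (h.ge.trans (EffRel.ker_le_ker_comp _ _)))

/-- The closure `q⁻¹(R[η])` of `S`, for a chosen quotient `q` by `S` and a chosen reflection. -/
noncomputable def closure {X : C} (S : EffRel X) : EffRel X :=
  (EffRel.ker (L.reflective.choose.adj.unit.app S.exists_quotient.choose)).inv
    S.exists_quotient.choose_spec.choose

theorem closure_ker (r : Reflective L.obj.ι) {X Q : C} (q : X ⟶ Q) [IsRegularEpi q] :
    L.closure (EffRel.ker q) = EffRel.ker (q ≫ r.adj.unit.app Q) := by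
  have := (EffRel.ker q).exists_quotient.choose_spec.choose_spec.1
  rw [closure, EffRel.ker_inv]
  exact L.ker_comp_unit_eq _ _ _ _ (EffRel.ker q).exists_quotient.choose_spec.choose_spec.2

theorem le_closure {X : C} (S : EffRel X) : S ≤ L.closure S := by
  obtain ⟨Q, q, _, rfl⟩ := S.exists_quotient
  rw [L.closure_ker L.reflective.choose]
  exact EffRel.ker_le_ker_comp _ _

theorem closure_le_ker {X Y : C} {S : EffRel X} {f : X ⟶ Y} (hY : L.obj Y)
    (h : S ≤ EffRel.ker f) : L.closure S ≤ EffRel.ker f := by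
  obtain ⟨Q, q, _, rfl⟩ := S.exists_quotient
  rw [L.closure_ker L.reflective.choose]
  exact L.ker_comp_unit_le _ q hY h

theorem exists_closure_eq_ker {X : C} (S : EffRel X) :
    ∃ (Y : C) (f : X ⟶ Y), IsRegularEpi f ∧ L.obj Y ∧ L.closure S = EffRel.ker f := by
  obtain ⟨Q, q, _, rfl⟩ := S.exists_quotient
  obtain ⟨r, hr⟩ := L.reflective
  have := hr Q
  exact ⟨_, q ≫ r.adj.unit.app Q, isRegularEpi_comp _ _, (r.L.obj Q).property, L.closure_ker r q⟩

theorem closure_mono {X : C} {S T : EffRel X} (h : S ≤ T) : L.closure S ≤ L.closure T := by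
  obtain ⟨Y, f, -, hY, hf⟩ := L.exists_closure_eq_ker T
  rw [hf]
  exact L.closure_le_ker hY (h.trans ((L.le_closure T).trans hf.le))

/-- The effective closure operator of an epireflective subcategory. -/
noncomputable def closureOperator : EffectiveClosureOperator C where
  cl := L.closure
  le_cl := L.le_closure
  mono _ _ := L.closure_mono
  cl_inv_le f S := by
    obtain ⟨Z, g, -, hZ, hg⟩ := L.exists_closure_eq_ker S
    -- The inverse image of the closure is `R[f ≫ g]` with codomain in `L`, so minimality applies.
    have h := EffRel.inv_le_inv f (L.le_closure S)
    rw [hg, EffRel.ker_inv] at h ⊢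
    exact L.closure_le_ker hZ h
  idem S := by
    refine le_antisymm ?_ (L.le_closure _)
    obtain ⟨Z, g, -, hZ, hg⟩ := L.exists_closure_eq_ker S
    rw [hg]
    exact L.closure_le_ker hZ le_rfl
  cl_inv f _ S := by
    obtain ⟨Q, q, _, rfl⟩ := S.exists_quotient
    obtain ⟨r, -⟩ := L.reflective
    -- The composite `f ≫ q` is a quotient by `f⁻¹(R[q])` with the same codomain, hence the same
    -- unit.
    have := isRegularEpi_comp f q
    rw [EffRel.ker_inv, L.closure_ker r, L.closure_ker r, EffRel.ker_inv, Category.assoc]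

theorem obj_iff_closure_diag (X : C) :
    L.obj X ↔ L.closure (EffRel.diag X) = EffRel.diag X := by
  constructor
  · intro hX
    refine le_antisymm ?_ (L.le_closure _)
    rw [← EffRel.ker_id]
    exact L.closure_le_ker hX le_rfl
  · intro h
    obtain ⟨Y, f, _, hY, hf⟩ := L.exists_closure_eq_ker (EffRel.diag X)
    -- A regular epimorphism with discrete kernel pair is an isomorphism, here onto an object of
    -- `L`.
    have : Mono f := EffRel.mono_of_ker_le_diag (hf.symm.trans h).le
    have : IsIso f := isIso_of_mono_of_strongEpi f
    have := L.replete
    exact L.obj.prop_of_iso (asIso f).symm hY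

/-- With `R[g]` the closure of `S` and `P` the quotient of `Y` by its image, `P` is a regular
quotient of the codomain of `g`, so it lies in `L`; minimality then bounds the closure of the image.
The other inequality needs only axioms (2) and (5). -/
theorem IsBirkhoff.closureOperator [IsExactCategory C] [IsGoursat C]
    {L : EpireflectiveSubcategory C} (hL : L.IsBirkhoff) : L.closureOperator.IsBirkhoff := by
  intro X Y f _ S
  apply le_antisymm
  · obtain ⟨Z, g, _, hZ, hg⟩ := L.exists_closure_eq_ker S
    obtain ⟨P, p, _, hp⟩ := ((L.closure S).image f).exists_quotient
    have hle : EffRel.ker g ≤ EffRel.ker (f ≫ p) := by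
      rw [← hg, ← EffRel.ker_inv, ← EffRel.image_le_iff, hp]
    obtain ⟨k, hk⟩ := EffRel.exists_desc g hle
    have : IsRegularEpi (g ≫ k) := hk ▸ isRegularEpi_comp f p
    have hP : L.obj P := hL k (isRegularEpi_of_comp g k) hZ
    change L.closure (S.image f) ≤ (L.closure S).image f
    rw [← hp]
    refine L.closure_le_ker hP ?_
    rw [hp, EffRel.image_le_iff]
    exact (L.le_closure S).trans ((EffRel.image_le_iff f).1 le_rfl)
  · rw [EffRel.image_le_iff, ← L.closureOperator.cl_inv]
    exact L.closureOperator.mono _ _ ((EffRel.image_le_iff f).1 le_rfl)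

end EpireflectiveSubcategory

/-! ### From closure operators to epireflective subcategories -/

namespace EffectiveClosureOperator

variable (c : EffectiveClosureOperator C)

/-- The objects with closed diagonal. -/
def closedDiagonal : ObjectProperty C := fun X => c.cl (EffRel.diag X) = EffRel.diag X

/-- Axiom (5) applied to `R[f] = f⁻¹(Δ_Y)`; it reduces the operator to its values on diagonals. -/
theorem cl_ker_of_isRegularEpi {X Y : C} (f : X ⟶ Y) [IsRegularEpi f] :
    c.cl (EffRel.ker f) = (c.cl (EffRel.diag Y)).inv f := by
  rw [← EffRel.diag_inv, c.cl_inv]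

theorem closedDiagonal_iff_cl_ker {X Y : C} (f : X ⟶ Y) [IsRegularEpi f] :
    c.closedDiagonal Y ↔ c.cl (EffRel.ker f) = EffRel.ker f := by
  rw [cl_ker_of_isRegularEpi, ← EffRel.diag_inv, (EffRel.inv_injective f).eq_iff]
  rfl

theorem cl_diag_le_ker {X Y : C} (hY : c.closedDiagonal Y) (f : X ⟶ Y) :
    c.cl (EffRel.diag X) ≤ EffRel.ker f :=
  calc c.cl (EffRel.diag X) ≤ c.cl ((EffRel.diag Y).inv f) := c.mono _ _ (EffRel.diag_le _)
    _ ≤ (c.cl (EffRel.diag Y)).inv f := c.cl_inv_le _ _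
    _ = EffRel.ker f := by rw [show c.cl (EffRel.diag Y) = _ from hY, EffRel.diag_inv]

theorem isClosedUnderIsomorphisms_closedDiagonal :
    c.closedDiagonal.IsClosedUnderIsomorphisms where
  of_iso {X Y} e hX := by
    have h : EffRel.ker e.inv = EffRel.diag Y := by
      rw [← EffRel.ker_id, ← EffRel.ker_comp_mono (𝟙 Y) e.inv, Category.id_comp]
    change c.cl (EffRel.diag Y) = _
    rw [← h]
    exact (c.closedDiagonal_iff_cl_ker e.inv).1 hX

/-- The quotient of `A` by the closure of its diagonal. -/
noncomputable def reflectionObj (A : C) : c.closedDiagonal.FullSubcategory where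
  obj := (c.cl (EffRel.diag A)).exists_quotient.choose
  property := by
    have h := (c.cl (EffRel.diag A)).exists_quotient.choose_spec.choose_spec
    have := h.1
    -- The diagonal of a quotient is closed exactly when the kernel pair of the projection is; here
    -- that kernel pair is itself a closure.
    rw [c.closedDiagonal_iff_cl_ker (c.cl (EffRel.diag A)).exists_quotient.choose_spec.choose, h.2,
      c.idem]

/-- The projection of `A` to its quotient by the closure of its diagonal. -/
noncomputable def reflectionUnit (A : C) : A ⟶ (c.reflectionObj A).obj :=
  (c.cl (EffRel.diag A)).exists_quotient.choose_spec.choose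

instance (A : C) : IsRegularEpi (c.reflectionUnit A) :=
  (c.cl (EffRel.diag A)).exists_quotient.choose_spec.choose_spec.1

theorem ker_reflectionUnit (A : C) : EffRel.ker (c.reflectionUnit A) = c.cl (EffRel.diag A) :=
  (c.cl (EffRel.diag A)).exists_quotient.choose_spec.choose_spec.2

theorem exists_reflectionUnit_desc {A Y : C} (hY : c.closedDiagonal Y) (f : A ⟶ Y) :
    ∃ g, c.reflectionUnit A ≫ g = f :=
  EffRel.exists_desc _ ((c.ker_reflectionUnit A).le.trans (c.cl_diag_le_ker hY f))

/-- Composition with the unit, as a bijection on hom-sets. -/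
noncomputable def reflectionEquiv (A : C) (Y : c.closedDiagonal.FullSubcategory) :
    (c.reflectionObj A ⟶ Y) ≃ (A ⟶ c.closedDiagonal.ι.obj Y) :=
  Equiv.ofBijective (fun g => c.reflectionUnit A ≫ g.hom)
    ⟨fun g g' h => by
      have : Epi (c.reflectionUnit A) := inferInstance
      ext
      exact (cancel_epi _).1 h,
    fun f => by
      obtain ⟨g, hg⟩ := c.exists_reflectionUnit_desc Y.property f
      exact ⟨ObjectProperty.homMk g, hg⟩⟩

theorem reflectionEquiv_comp (A : C) (Y Y' : c.closedDiagonal.FullSubcategory) (g : Y ⟶ Y')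
    (h : c.reflectionObj A ⟶ Y) :
    c.reflectionEquiv A Y' (h ≫ g) = c.reflectionEquiv A Y h ≫ c.closedDiagonal.ι.map g :=
  (Category.assoc _ _ _).symm

/-- The full subcategory of objects with closed diagonal is reflective. -/
@[reducible]
noncomputable def reflective : Reflective c.closedDiagonal.ι where
  L := Adjunction.leftAdjointOfEquiv c.reflectionEquiv c.reflectionEquiv_comp
  adj := Adjunction.adjunctionOfEquivLeft c.reflectionEquiv c.reflectionEquiv_comp

theorem reflective_unit_app (A : C) : c.reflective.adj.unit.app A = c.reflectionUnit A :=
  (Adjunction.adjunctionOfEquivLeft_unit_app _ c.reflectionEquiv_comp A).trans (Category.comp_id _)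

/-- The epireflective subcategory of objects with closed diagonal. -/
def subcategory : EpireflectiveSubcategory C where
  obj := c.closedDiagonal
  replete := c.isClosedUnderIsomorphisms_closedDiagonal
  reflective := ⟨c.reflective, fun A => by
    rw [reflective_unit_app]
    exact inferInstanceAs (IsRegularEpi (c.reflectionUnit A))⟩

/-- For `S = R[q]`, with `η` the unit at `Q`: `R[q ≫ η] = q⁻¹(R[η]) = q⁻¹(cl Δ_Q) = cl R[q]`. -/
theorem closureOperator_subcategory : c.subcategory.closureOperator = c := by
  refine EffectiveClosureOperator.ext ?_
  funext X S
  obtain ⟨Q, q, _, rfl⟩ := S.exists_quotient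
  refine (c.subcategory.closure_ker c.reflective q).trans
    ((congrArg (fun η => EffRel.ker (q ≫ η)) (c.reflective_unit_app Q)).trans ?_)
  refine (EffRel.ker_inv q (c.reflectionUnit Q)).symm.trans ?_
  rw [ker_reflectionUnit, ← cl_ker_of_isRegularEpi]

/-- Axiom (6) at `S = Δ_X` suffices, since the image of `Δ_X` along a regular epimorphism is `Δ_Y`.
-/
theorem IsBirkhoff.subcategory [IsExactCategory C] [IsGoursat C]
    {c : EffectiveClosureOperator C} (hc : c.IsBirkhoff) : c.subcategory.IsBirkhoff := by
  intro X Y f _ hX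
  change c.cl (EffRel.diag Y) = _
  rw [← EffRel.image_diag f, hc, show c.cl (EffRel.diag X) = _ from hX]

end EffectiveClosureOperator

/-! ### The bijection and its restriction to the Birkhoff case -/

variable (C) in
/-- The bijection between epireflective subcategories and effective closure operators. -/
noncomputable def epireflectiveEquiv :
    EpireflectiveSubcategory C ≃ EffectiveClosureOperator C where
  toFun L := L.closureOperator
  invFun c := c.subcategory
  left_inv L := EpireflectiveSubcategory.ext (funext fun X =>
    propext (L.obj_iff_closure_diag X).symm)
  right_inv c := c.closureOperator_subcategory

end EffClosure

theorem mainTheorem2 (C : Type u) [Category.{v} C] [Regular C] [IsExactCategory C] [IsGoursat C] :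
    ∃ e : EpireflectiveSubcategory C ≃ EffectiveClosureOperator C,
      -- `e` sends a subcategory to the operator `S ↦ q⁻¹(R[η])`, with `q` the quotient by `S`
      -- and `η` the unit of the reflection at this quotient
      (∀ (L : EpireflectiveSubcategory C) (r : Reflective L.obj.ι) (X : C) (S : EffRel X) (Q : C)
        (q : X ⟶ Q) (w : p₁ S.rel ≫ q = p₂ S.rel ≫ q), IsColimit (Cofork.ofπ q w) →
          (e L).cl S = (EffRel.ker (r.adj.unit.app Q)).inv q) ∧
      -- its inverse sends an operator to the subcategory of objects with closed diagonal
      (∀ (c : EffectiveClosureOperator C) (X : C),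
        (e.symm c).obj X ↔ c.cl (EffRel.diag X) = EffRel.diag X) ∧
      -- and it restricts to a bijection between the Birkhoff ones on both sides
      Set.BijOn e {L | L.IsBirkhoff} {c | c.IsBirkhoff} := by
  refine ⟨epireflectiveEquiv C, fun L r X S Q q w hq => ?_, fun c X => Iff.rfl, ?_⟩
  · have : IsRegularEpi q := ⟨⟨Cofork.IsColimit.regularEpi hq⟩⟩
    -- Once `S` is `R[q]`, `closure_ker` covers any quotient and any reflection, not just the chosen
    -- ones.
    obtain rfl := EffRel.ker_eq_of_isColimit w hq
    exact (L.closure_ker r q).trans (EffRel.ker_inv _ _).symm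
  · refine ⟨fun L hL => hL.closureOperator, (epireflectiveEquiv C).injective.injOn,
      fun c hc => ⟨c.subcategory, hc.subcategory, c.closureOperator_subcategory⟩⟩
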